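/- Let $\mathbb S^1=\mathbb R/2\pi\mathbb Z$, $\mathbb T^3=(\mathbb S^1)^3$, and let $f_1,f_2,f_3:\mathbb S^1\to\mathbb R$ be non-constant real-analytic functions such that, for each $i$, $f_i$ and $f_i'$ have no common zero and $f_i'$ and $f_i''$ have no common zero. Consider on $\mathbb T^3$ the vector fields $$X_1(x)=(f_1(x_3),f_1'(x_3),0),\quad X_2(x)=(0,f_2(x_1),f_2'(x_1)),\quad X_3(x)=(f_3'(x_2),0,f_3(x_2)),$$ with flows $\varphi^{(i)}_t(x)=x+tX_i(x)\pmod{2\pi}$. Fix $h>0$, let $\tau_1,\tau_2,\dots$ be independent exponentially distributed random variables with mean $h$, and let the one-point chain be $\Phi^0_{\underline\tau}=I$, $\Phi^m_{\underline\tau}=\varphi^{(3)}_{\tau_{3m}}\circ\varphi^{(2)}_{\tau_{3m-1}}\circ\varphi^{(1)}_{\tau_{3m-2}}\circ\Phi^{m-1}_{\underline\tau}$ for $m\ge1$. Its transition kernel is $P(x,D)=\mathbb P(\Phi^1_{\underline\tau}(x)\in D)$ for $x\in\mathbb T^3$ and Borel sets $D\subseteq\mathbb T^3$; write $P^mg(x)=\int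 g(y)\,P^m(x,dy)$. A Borel probability measure $\mu$ on $\mathbb T^3$ is stationary if $\int P(x,D)\,\mu(dx)=\mu(D)$ for all Borel sets $D$. **Theorem 2.2 (Uniform geometric ergodicity of the one-point chain).** The normalized Lebesgue measure $\mu$ on $\mathbb T^3$ is the unique stationary probability measure of $P$, and $P$ is uniformly geometrically ergodic: there exist constants $C>0$ and $\gamma\in(0,1)$ such that $$\Big|P^mg(x)-\int g\,d\mu\Big|\le C\,\Big(\sup_{y\in\mathbb T^3}|g(y)|\Big)\,\gamma^m$$ for all $m\in\mathbb N$ (including $m=0$), all $x\in\mathbb T^3$ and all bounded Borel measurable $g:\mathbb T^3\to\mathbb R$. -/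

import Mathlib

open MeasureTheory ProbabilityTheory

noncomputable section

namespace RandomSplitting

instance instFactTwoPiPos : Fact (0 < 2 * Real.pi) := ⟨Real.two_pi_pos⟩

/-- The circle `𝕊¹ = ℝ / 2πℤ`. -/
abbrev Circ : Type := AddCircle (2 * Real.pi)

/-- The torus `𝕋³ = (ℝ / 2πℤ)³`, with coordinates indexed by `0, 1, 2`. -/
abbrev Torus : Type := Fin 3 → Circ

/-- The Lebesgue probability measure on `𝕋³` (normalized volume). -/
def lebesgue : Measure Torus := (volume (Set.univ : Set Torus))⁻¹ • volume

/-- The derivative of a function on the circle with respect to the angle. -/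
def circDeriv (g : Circ → ℝ) (x : Circ) : ℝ := deriv (fun t : ℝ => g (x + (t : Circ))) 0

/-- Standing assumptions on the profiles: `f₁, f₂, f₃ ∈ C^ω(𝕊¹, ℝ)` (that is, the associated
`2π`-periodic functions on `ℝ` are real analytic) are non-constant, and neither `fᵢ, fᵢ'` nor
`fᵢ', fᵢ''` have a common zero. -/
structure IsAdmissible (f : Fin 3 → Circ → ℝ) : Prop where
  analytic : ∀ i, AnalyticOnNhd ℝ (fun t : ℝ => f i (t : Circ)) Set.univ
  nonconst : ∀ i, ¬ ∃ c : ℝ, ∀ x, f i x = c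
  no_common_zero : ∀ i x, ¬ (f i x = 0 ∧ circDeriv (f i) x = 0)
  no_common_zero' : ∀ i x, ¬ (circDeriv (f i) x = 0 ∧ circDeriv (circDeriv (f i)) x = 0)

/-- The three vector fields `X₁, X₂, X₃` on the torus. -/
def vectorField (f : Fin 3 → Circ → ℝ) : Fin 3 → Torus → (Fin 3 → ℝ)
  | 0, x => ![f 0 (x 2), circDeriv (f 0) (x 2), 0]
  | 1, x => ![0, f 1 (x 0), circDeriv (f 1) (x 0)]
  | 2, x => ![circDeriv (f 2) (x 1), 0, f 2 (x 1)]

/-- The flow `φ_t^{(i)}` of `X_i`, namely `x ↦ x + t X_i(x)` modulo `2π`. It is the flow because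
`X_i` is constant along these lines, see `vectorField_flow`. -/
def flow (f : Fin 3 → Circ → ℝ) (i : Fin 3) (t : ℝ) (x : Torus) : Torus :=
  fun j => x j + ((t * vectorField f i x j : ℝ) : Circ)

theorem vectorField_flow (f : Fin 3 → Circ → ℝ) (i : Fin 3) (t : ℝ) (x : Torus) :
    vectorField f i (flow f i t x) = vectorField f i x := by
  fin_cases i <;> simp [vectorField, flow]

/-- The random splitting `Φ_τ^m`. The times are indexed from `0`, so that `t n` is the `(n+1)`-st
time. -/
def splitting (f : Fin 3 → Circ → ℝ) (t : ℕ → ℝ) : ℕ → Torus → Torus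
  | 0 => id
  | m + 1 => fun x =>
      flow f 2 (t (3 * m + 2)) (flow f 1 (t (3 * m + 1)) (flow f 0 (t (3 * m))
        (splitting f t m x)))

section Measurability

variable {f : Fin 3 → Circ → ℝ}

theorem circDeriv_coe (g : Circ → ℝ) (s : ℝ) :
    circDeriv g (s : Circ) = deriv (fun t : ℝ => g (t : Circ)) s := by
  have h := deriv_comp_const_add (fun t : ℝ => g (t : Circ)) s 0
  simpa [circDeriv] using h

theorem continuous_of_coe {g : Circ → ℝ} (hg : Continuous (fun t : ℝ => g (t : Circ))) :
    Continuous g :=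
  (QuotientAddGroup.isQuotientMap_mk (N := AddSubgroup.zmultiples (2 * Real.pi))).continuous_iff.2 hg

theorem IsAdmissible.continuous (hf : IsAdmissible f) (i : Fin 3) : Continuous (f i) :=
  continuous_of_coe
    (continuousOn_univ.1 (hf.analytic i).continuousOn)

theorem IsAdmissible.continuous_circDeriv (hf : IsAdmissible f) (i : Fin 3) :
    Continuous (circDeriv (f i)) := by
  refine continuous_of_coe ?_
  simp only [circDeriv_coe]
  exact continuousOn_univ.1 (hf.analytic i).deriv.continuousOn

theorem IsAdmissible.continuous_vectorField (hf : IsAdmissible f) (i : Fin 3) :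
    Continuous (vectorField f i) := by
  have h0 := hf.continuous
  have h1 := hf.continuous_circDeriv
  refine continuous_pi fun j => ?_
  fin_cases i <;> fin_cases j <;> simp [vectorField] <;> fun_prop

theorem IsAdmissible.continuous_flow (hf : IsAdmissible f) (i : Fin 3) :
    Continuous (fun p : ℝ × Torus => flow f i p.1 p.2) := by
  have h := hf.continuous_vectorField i
  refine continuous_pi fun j => ?_
  refine Continuous.add (by fun_prop) ((AddCircle.continuous_mk' _).comp ?_)
  fun_prop

theorem IsAdmissible.measurable_splitting (hf : IsAdmissible f) {Ω : Type*} [MeasurableSpace Ω]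
    {τ : ℕ → Ω → ℝ} (hτ : ∀ n, Measurable (τ n)) (m : ℕ) :
    Measurable (fun p : Torus × Ω => splitting f (fun n => τ n p.2) m p.1) := by
  have key : ∀ (i : Fin 3) (n : ℕ) (F : Torus × Ω → Torus), Measurable F →
      Measurable (fun p => flow f i (τ n p.2) (F p)) := fun i n F hF =>
    (hf.continuous_flow i).measurable.comp (((hτ n).comp measurable_snd).prodMk hF)
  induction m with
  | zero => exact measurable_fst
  | succ m ih => exact key _ _ _ (key _ _ _ (key _ _ _ ih))

end Measurability

/-- The transition kernel `P(x, D) = Pr(Φ_τ(x) ∈ D)` of the one-point chain: `P(x, ·)` is the law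
of `Φ_τ(x) = Φ_τ^1(x)`. -/
def onePointKernel {f : Fin 3 → Circ → ℝ} (hf : IsAdmissible f) {Ω : Type*} [MeasurableSpace Ω]
    (Pr : Measure Ω) [IsProbabilityMeasure Pr] {τ : ℕ → Ω → ℝ} (hτ : ∀ n, Measurable (τ n)) :
    Kernel Torus Torus where
  toFun x := Pr.map (fun ω => splitting f (fun n => τ n ω) 1 x)
  measurable' := by
    have hm := hf.measurable_splitting hτ 1
    refine Measure.measurable_of_measurable_coe _ fun s hs => ?_
    have : ∀ x, Pr.map (fun ω => splitting f (fun n => τ n ω) 1 x) s =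
        Pr (Prod.mk x ⁻¹' ((fun p : Torus × Ω => splitting f (fun n => τ n p.2) 1 p.1) ⁻¹' s)) :=
      fun x => Measure.map_apply (hm.comp measurable_prodMk_left) hs
    simp only [this]
    exact measurable_measure_prodMk_left (hm hs)

/-- `μ` is a stationary (probability) measure of `P`, i.e. `P^* μ = μ`. -/
def IsStationary {M : Type*} [MeasurableSpace M] (P : Kernel M M) (μ : Measure M) : Prop :=
  IsProbabilityMeasure μ ∧ P.Invariant μ

/-- The weighted supremum norm `‖g‖_V`. -/
def weightedNorm {M : Type*} (V g : M → ℝ) : ℝ := ⨆ x, |g x| / V x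

/-- The space `𝓜_V` of measurable `g` with `‖g‖_V < ∞`. -/
def MemWeighted {M : Type*} [MeasurableSpace M] (V g : M → ℝ) : Prop :=
  Measurable g ∧ BddAbove (Set.range fun x => |g x| / V x)

/-- `V`-uniform geometric ergodicity. Here `(P ^ m) x` is the `m`-step transition probability, so
`∫ y, g y ∂((P ^ m) x)` is `P^m g (x)`. -/
def IsVUniformlyGeometricallyErgodic {M : Type*} [MeasurableSpace M] (P : Kernel M M)
    (V : M → ℝ) : Prop :=
  ∃ μ : Measure M, IsStationary P μ ∧ (∀ ν : Measure M, IsStationary P ν → ν = μ) ∧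
    ∃ C γ : ℝ, 0 < C ∧ 0 < γ ∧ γ < 1 ∧
      ∀ (m : ℕ) (x : M) (g : M → ℝ), MemWeighted V g →
        Integrable g ((P ^ m) x) ∧ Integrable g μ ∧
        |(∫ y, g y ∂((P ^ m) x)) - (∫ y, g y ∂μ)| ≤ C * V x * weightedNorm V g * γ ^ m

/-- Uniform geometric ergodicity: the case `V ≡ 1`. -/
def IsUniformlyGeometricallyErgodic {M : Type*} [MeasurableSpace M] (P : Kernel M M) : Prop :=
  IsVUniformlyGeometricallyErgodic P fun _ => 1

end RandomSplitting

end

namespace RandomSplitting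

open Filter Topology Set
open scoped ENNReal

/-! ### Doeblin contraction for Markov kernels -/

section Doeblin

variable {X : Type*} [MeasurableSpace X]

/-! By Doeblin's theorem (`exists_geometric_bound_of_minorization`) it is enough to bound some
iterate `P ^ N` from below by one nonzero measure, uniformly in the starting point: each such
iterate shrinks the oscillation of a function by a fixed factor. Uniqueness follows from the
convergence (`eq_of_geometric_bound`), and Lebesgue measure is invariant because every flow is a
shear (`lintegral_flow`).

The minorization is first local. If `f 0 (x 2) ≠ 0`, suitable times make the cycle a submersion in
its three times (`IsAdmissible.eq_zero_of_fderiv_liftCycle_eq_zero`), so the positive density of the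
exponential times gives a positive density of positions, uniformly near `x`
(`exists_smul_restrict_le_map`). If `f 0 (x 2) = 0`, one extra cycle leads to the first case
(`exists_cycle_profile_ne_zero`).

Passing from local to global needs no explicit controllability argument (`exists_minorization`): the
points from which a given small open set is reachable form an open set, which invariance of a fully
supported measure together with the local minorization forces to be closed. Connectedness makes it
the whole torus, and compactness makes the number of steps and the probability uniform. -/

theorem isMarkovKernel_pow (P : Kernel X X) [IsMarkovKernel P] (n : ℕ) :
    IsMarkovKernel (P ^ n) := by
  induction n with
  | zero => exact inferInstanceAs (IsMarkovKernel Kernel.id)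
  | succ n ih =>
    rw [Kernel.pow_add]
    have : IsMarkovKernel (P ^ 1) := by rwa [pow_one]
    infer_instance

theorem invariant_pow {P : Kernel X X} {μ : Measure X} (hμ : P.Invariant μ) (n : ℕ) :
    (P ^ n).Invariant μ := by
  induction n with
  | zero => exact Measure.bind_dirac
  | succ n ih =>
    rw [Kernel.pow_add]
    exact ih.comp (by rwa [pow_one])

theorem integrable_of_mem_Icc {μ : Measure X} [IsFiniteMeasure μ] {g : X → ℝ} (hg : Measurable g)
    {a b : ℝ} (hab : ∀ x, g x ∈ Icc a b) : Integrable g μ :=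
  Integrable.of_mem_Icc a b hg.aemeasurable (ae_of_all _ hab)

theorem integral_mem_Icc {μ : Measure X} [IsProbabilityMeasure μ] {g : X → ℝ} (hg : Measurable g)
    {a b : ℝ} (hab : ∀ x, g x ∈ Icc a b) : ∫ y, g y ∂μ ∈ Icc a b := by
  have hi := integrable_of_mem_Icc (μ := μ) hg hab
  constructor
  · simpa using integral_mono (integrable_const a) hi fun x => (hab x).1
  · simpa using integral_mono hi (integrable_const b) fun x => (hab x).2

theorem measurable_integral_kernel {κ : Kernel X X} [IsMarkovKernel κ] {g : X → ℝ}
    (hg : Measurable g) : Measurable fun x => ∫ y, g y ∂κ x :=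
  hg.stronglyMeasurable.integral_kernel.measurable

theorem integral_bind_kernel {κ : Kernel X X} [IsMarkovKernel κ] {μ : Measure X}
    [IsProbabilityMeasure μ] {g : X → ℝ} (hg : Integrable g (μ.bind ⇑κ)) :
    ∫ y, g y ∂(μ.bind ⇑κ) = ∫ x, ∫ y, g y ∂κ x ∂μ := by
  rw [Measure.comp_eq_comp_const_apply] at hg ⊢
  rw [Kernel.integral_comp hg, Kernel.const_apply]

/-- A kernel minorized by `ν` maps a function with values in an interval to a function with values
in an interval that is shorter by the factor `1 - ν X`. -/
theorem exists_integral_mem_Icc_of_minorization {κ : Kernel X X} [IsMarkovKernel κ]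
    {ν : Measure X} [IsFiniteMeasure ν] (hν : ∀ x, ν ≤ κ x) {g : X → ℝ} (hg : Measurable g)
    {a b : ℝ} (hab : ∀ x, g x ∈ Icc a b) :
    ∃ a' b', b' - a' = (1 - ν.real univ) * (b - a) ∧ ∀ x, ∫ y, g y ∂κ x ∈ Icc a' b' := by
  have hiν := integrable_of_mem_Icc (μ := ν) hg hab
  -- Both `g - a` and `b - g` are nonnegative, so their `κ x`-integrals dominate their
  -- `ν`-integrals; the two gains add up to `(b - a)` times the mass of `ν`.
  refine ⟨a + ∫ y, (g y - a) ∂ν, b - ∫ y, (b - g y) ∂ν, ?_, fun x => ?_⟩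
  · rw [integral_sub hiν (integrable_const a), integral_sub (integrable_const b) hiν]
    simp only [integral_const, smul_eq_mul]
    ring
  · have hi := integrable_of_mem_Icc (μ := κ x) hg hab
    have h1 : ∫ y, (g y - a) ∂ν ≤ ∫ y, (g y - a) ∂κ x :=
      integral_mono_measure (hν x) (ae_of_all _ fun y => sub_nonneg.2 (hab y).1)
        (hi.sub (integrable_const a))
    have h2 : ∫ y, (b - g y) ∂ν ≤ ∫ y, (b - g y) ∂κ x :=
      integral_mono_measure (hν x) (ae_of_all _ fun y => sub_nonneg.2 (hab y).2)
        ((integrable_const b).sub hi)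
    rw [integral_sub hi (integrable_const a)] at h1
    rw [integral_sub (integrable_const b) hi] at h2
    simp only [integral_const, smul_eq_mul, probReal_univ, one_mul] at h1 h2
    constructor <;> linarith

theorem exists_integral_pow_mem_Icc {κ : Kernel X X} [IsMarkovKernel κ]
    {ν : Measure X} [IsFiniteMeasure ν] (hν : ∀ x, ν ≤ κ x) {g : X → ℝ} (hg : Measurable g)
    {a b : ℝ} (hab : ∀ x, g x ∈ Icc a b) (k : ℕ) :
    ∃ a' b', b' - a' = (1 - ν.real univ) ^ k * (b - a) ∧
      ∀ x, ∫ y, g y ∂(κ ^ k) x ∈ Icc a' b' := by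
  induction k with
  | zero =>
    have := isMarkovKernel_pow κ 0
    exact ⟨a, b, by simp, fun x => integral_mem_Icc hg hab⟩
  | succ k ih =>
    obtain ⟨a₁, b₁, h₁, h⟩ := ih
    have := isMarkovKernel_pow κ k
    obtain ⟨a₂, b₂, h₂, h'⟩ :=
      exists_integral_mem_Icc_of_minorization hν (measurable_integral_kernel hg) h
    refine ⟨a₂, b₂, by rw [h₂, h₁]; ring, fun x => ?_⟩
    have hint : Integrable g (((κ ^ k) ∘ₖ κ) x) := integrable_of_mem_Icc hg hab
    have : κ ^ (k + 1) = (κ ^ k) ∘ₖ κ := by rw [Kernel.pow_add, pow_one]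
    rw [this, Kernel.integral_comp hint]
    exact h' x

/-- Doeblin's theorem: a global minorization of some iterate yields geometric convergence to an
invariant probability measure. -/
theorem exists_geometric_bound_of_minorization {P : Kernel X X} [IsMarkovKernel P]
    {μ : Measure X} [IsProbabilityMeasure μ] (hμ : P.Invariant μ) {N : ℕ} (hN : 0 < N)
    {ν : Measure X} [IsFiniteMeasure ν] (hν0 : ν ≠ 0) (hν : ∀ x, ν ≤ (P ^ N) x) :
    ∃ C γ : ℝ, 0 < C ∧ 0 < γ ∧ γ < 1 ∧ ∀ (m : ℕ) (x : X) (g : X → ℝ) (r : ℝ), Measurable g →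
      (∀ y, |g y| ≤ r) → |(∫ y, g y ∂((P ^ m) x)) - ∫ y, g y ∂μ| ≤ C * r * γ ^ m := by
  have hmk := isMarkovKernel_pow P
  have hε0 : 0 < ν.real univ := by
    rw [measureReal_def]
    exact ENNReal.toReal_pos (by simpa using hν0) (measure_ne_top _ _)
  obtain ⟨x₀⟩ : Nonempty X := by
    by_contra h
    rw [not_nonempty_iff] at h
    exact hν0 (Subsingleton.elim _ _)
  have hε1 : ν.real univ ≤ 1 := by
    have h := hν x₀ univ
    rw [measure_univ (μ := (P ^ N) x₀)] at h
    exact ENNReal.toReal_le_of_le_ofReal zero_le_one (by simpa only [ENNReal.ofReal_one] using h)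
  -- Halving the mass keeps `ρ` positive even if `ν` has mass `1`.
  set ρ : ℝ := 1 - ν.real univ / 2 with hρ
  have hρ0 : 0 < ρ := by linarith
  have hρ1 : ρ < 1 := by linarith
  set γ : ℝ := ρ ^ ((N : ℝ)⁻¹) with hγ
  have hγ0 : 0 < γ := Real.rpow_pos_of_pos hρ0 _
  have hγN : γ ^ N = ρ := Real.rpow_inv_natCast_pow hρ0.le hN.ne'
  have hγ1 : γ < 1 := Real.rpow_lt_one hρ0.le hρ1 (by positivity)
  refine ⟨2 / ρ, γ, by positivity, hγ0, hγ1, fun m x g r hg hr => ?_⟩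
  have hr0 : 0 ≤ r := (abs_nonneg _).trans (hr x)
  have hab : ∀ y, g y ∈ Icc (-r) r := fun y => abs_le.1 (hr y)
  obtain ⟨a, b, hl, hk⟩ := exists_integral_pow_mem_Icc hν hg hab (m / N)
  -- The remaining `m % N` steps only average, so they stay in the interval reached by the full
  -- blocks.
  have hm : P ^ m = ((P ^ N) ^ (m / N)) ∘ₖ (P ^ (m % N)) := by
    rw [← pow_mul, ← Kernel.pow_add, Nat.div_add_mod]
  have hmkN := isMarkovKernel_pow (P ^ N) (m / N)
  have h1 : ∫ y, g y ∂((P ^ m) x) ∈ Icc a b := by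
    have hint : Integrable g ((((P ^ N) ^ (m / N)) ∘ₖ (P ^ (m % N))) x) := integrable_of_mem_Icc hg hab
    rw [hm, Kernel.integral_comp hint]
    exact integral_mem_Icc (measurable_integral_kernel hg) hk
  have h2 : ∫ y, g y ∂μ ∈ Icc a b := by
    have hinv : μ.bind ⇑((P ^ N) ^ (m / N)) = μ := by
      rw [← pow_mul]; exact invariant_pow hμ _
    have hint : Integrable g (μ.bind ⇑((P ^ N) ^ (m / N))) := by
      rw [hinv]; exact integrable_of_mem_Icc hg hab
    rw [← hinv, integral_bind_kernel hint]
    exact integral_mem_Icc (measurable_integral_kernel hg) hk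
  have h3 : |(∫ y, g y ∂((P ^ m) x)) - ∫ y, g y ∂μ| ≤ b - a := by
    rw [abs_le]
    constructor <;> linarith [h1.1, h1.2, h2.1, h2.2]
  have h4 : (1 - ν.real univ) ^ (m / N) ≤ ρ ^ (m / N) :=
    pow_le_pow_left₀ (by linarith) (by linarith) _
  -- The incomplete block costs one factor `ρ`, hence the constant `2 / ρ`; the `2` is the length of
  -- `[-r, r]` relative to `r`.
  have h5 : ρ ^ (m / N) * ρ ≤ γ ^ m := by
    rw [← pow_succ, ← hγN, ← pow_mul]
    exact pow_le_pow_of_le_one hγ0.le hγ1.le (Nat.lt_mul_div_succ m hN).le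
  have h6 : ρ ^ (m / N) ≤ γ ^ m / ρ := by rwa [le_div_iff₀ hρ0]
  calc |(∫ y, g y ∂((P ^ m) x)) - ∫ y, g y ∂μ|
      ≤ (1 - ν.real univ) ^ (m / N) * (r - -r) := by rw [← hl]; exact h3
    _ ≤ (γ ^ m / ρ) * (r - -r) :=
        mul_le_mul_of_nonneg_right (h4.trans h6) (by linarith)
    _ = 2 / ρ * r * γ ^ m := by ring

/-- Integrating the bound for an indicator against `ν` leaves `ν s` unchanged by invariance, while
the error tends to zero. -/
theorem eq_of_geometric_bound {P : Kernel X X} [IsMarkovKernel P] {μ ν : Measure X}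
    [IsProbabilityMeasure μ] [IsProbabilityMeasure ν] (hν : P.Invariant ν) {C γ : ℝ}
    (hγ0 : 0 < γ) (hγ1 : γ < 1)
    (h : ∀ (m : ℕ) (x : X) (g : X → ℝ) (r : ℝ), Measurable g →
      (∀ y, |g y| ≤ r) → |(∫ y, g y ∂((P ^ m) x)) - ∫ y, g y ∂μ| ≤ C * r * γ ^ m) : ν = μ := by
  have hmk := isMarkovKernel_pow P
  ext s hs
  rw [← measureReal_eq_measureReal_iff]
  set g : X → ℝ := s.indicator 1 with hg
  have hgm : Measurable g := measurable_one.indicator hs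
  have hg1 : ∀ y, |g y| ≤ 1 := fun y => by
    by_cases hy : y ∈ s <;> simp [hg, hy]
  have hab : ∀ y, g y ∈ Icc (-1 : ℝ) 1 := fun y => abs_le.1 (hg1 y)
  have key : ∀ m, |ν.real s - μ.real s| ≤ C * 1 * γ ^ m := fun m => by
    have hinv : ν.bind ⇑(P ^ m) = ν := invariant_pow hν m
    have hint : Integrable g (ν.bind ⇑(P ^ m)) := by rw [hinv]; exact integrable_of_mem_Icc hgm hab
    have hb := fun x => abs_le.1 (h m x g 1 hgm hg1)
    have h1 := integral_mem_Icc (μ := ν) (measurable_integral_kernel (κ := P ^ m) hgm)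
      (a := (∫ y, g y ∂μ) - C * 1 * γ ^ m) (b := (∫ y, g y ∂μ) + C * 1 * γ ^ m)
      fun x => ⟨by linarith [(hb x).1], by linarith [(hb x).2]⟩
    rw [← integral_bind_kernel hint, hinv] at h1
    simp only [hg, integral_indicator_one hs] at h1
    rw [abs_le]
    constructor <;> linarith [h1.1, h1.2]
  have hlim : Tendsto (fun m : ℕ => C * 1 * γ ^ m) atTop (𝓝 0) := by
    simpa using (tendsto_pow_atTop_nhds_zero_of_lt_one hγ0.le hγ1).const_mul (C * 1)
  have := ge_of_tendsto' hlim key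
  exact sub_eq_zero.1 (abs_nonpos_iff.1 this)

end Doeblin

/-! ### From local to global minorization -/

section Topological

variable {X : Type*} [TopologicalSpace X] [MeasurableSpace X] [BorelSpace X]

theorem lowerSemicontinuous_lintegral_pow {P : Kernel X X}
    (hP : ∀ g : X → ℝ≥0∞, LowerSemicontinuous g → LowerSemicontinuous fun x => ∫⁻ y, g y ∂P x)
    (n : ℕ) {g : X → ℝ≥0∞} (hg : LowerSemicontinuous g) :
    LowerSemicontinuous fun x => ∫⁻ y, g y ∂(P ^ n) x := by
  induction n with
  | zero =>
    have : ∀ x, ∫⁻ y, g y ∂(P ^ 0) x = g x := fun x => lintegral_dirac' x hg.measurable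
    simpa only [this] using hg
  | succ n ih =>
    have : ∀ x, ∫⁻ y, g y ∂(P ^ (n + 1)) x = ∫⁻ z, ∫⁻ y, g y ∂(P ^ n) z ∂P x := fun x => by
      rw [Kernel.pow_add, pow_one, Kernel.lintegral_comp _ _ _ hg.measurable]
    simpa only [this] using hP _ ih

theorem lowerSemicontinuous_pow_apply {P : Kernel X X}
    (hP : ∀ g : X → ℝ≥0∞, LowerSemicontinuous g → LowerSemicontinuous fun x => ∫⁻ y, g y ∂P x)
    (n : ℕ) {O : Set X} (hO : IsOpen O) : LowerSemicontinuous fun x => (P ^ n) x O := by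
  have h := lowerSemicontinuous_lintegral_pow hP n
    (hO.lowerSemicontinuous_indicator (zero_le : 0 ≤ (1 : ℝ≥0∞)))
  simpa [lintegral_indicator hO.measurableSet] using h

/-- Chapman–Kolmogorov, keeping only the paths that are in `U` at time `n`. -/
theorem smul_le_pow_add {X : Type*} [MeasurableSpace X] {P : Kernel X X} {U : Set X} (hU : MeasurableSet U) {m : ℕ}
    {ν : Measure X} (hν : ∀ x ∈ U, ν ≤ (P ^ m) x) (n : ℕ) (x : X) :
    (P ^ n) x U • ν ≤ (P ^ (n + m)) x := by
  refine Measure.le_iff.2 fun s hs => ?_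
  rw [Kernel.pow_add_apply_eq_lintegral _ _ _ _ hs, Measure.smul_apply, smul_eq_mul, mul_comm,
    ← setLIntegral_const]
  exact (setLIntegral_mono' hU fun y hy => hν y hy s).trans (setLIntegral_le_lintegral _ _)

/-- On a compact connected space, a lazy Feller chain that preserves a measure of full support and
is locally minorized satisfies a global minorization. -/
theorem exists_minorization [CompactSpace X] [ConnectedSpace X] {P : Kernel X X} [IsMarkovKernel P]
    (hP : ∀ g : X → ℝ≥0∞, LowerSemicontinuous g → LowerSemicontinuous fun x => ∫⁻ y, g y ∂P x)
    (hlazy : ∀ (x : X) (O : Set X), IsOpen O → x ∈ O → P x O ≠ 0)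
    {μ : Measure X} [IsFiniteMeasure μ] [μ.IsOpenPosMeasure] (hμ : P.Invariant μ)
    (hloc : ∀ x₀ : X, ∃ (m : ℕ) (U : Set X) (ν : Measure X), IsOpen U ∧ x₀ ∈ U ∧ ν ≠ 0 ∧
      ∀ x ∈ U, ν ≤ (P ^ m) x) :
    ∃ (N : ℕ) (ν : Measure X), 0 < N ∧ ν ≠ 0 ∧ ∀ x, ν ≤ (P ^ N) x := by
  have hmk := isMarkovKernel_pow P
  obtain ⟨x₁⟩ : Nonempty X := inferInstance
  obtain ⟨m₁, U₁, ν₁, hU₁, hxU₁, hν₁, hmin₁⟩ := hloc x₁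
  have hlsc : ∀ n, LowerSemicontinuous fun x => (P ^ n) x U₁ :=
    fun n => lowerSemicontinuous_pow_apply hP n hU₁
  -- Points that can be in `U₁` at time `n`. Laziness makes these sets increase: a path that has
  -- reached the open set can stay in it for another step.
  let A : ℕ → Set X := fun n => {x | 0 < (P ^ n) x U₁}
  have hA : ∀ n, IsOpen (A n) := fun n => (hlsc n).isOpen_preimage 0
  have hmono : Monotone A := by
    refine monotone_nat_of_le_succ fun n x hx => ?_
    have hx' : 0 < (P ^ n) x U₁ := hx
    change 0 < (P ^ (n + 1)) x U₁
    rw [Kernel.pow_succ_apply_eq_lintegral _ _ _ hU₁.measurableSet]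
    rw [pos_iff_ne_zero] at hx' ⊢
    intro h0
    rw [lintegral_eq_zero_iff (P.measurable_coe hU₁.measurableSet)] at h0
    refine hx' (measure_mono_null (fun y hy => ?_) (ae_iff.1 h0))
    exact hlazy y U₁ hU₁ hy
  set W : Set X := ⋃ n, A n with hW
  have hWo : IsOpen W := isOpen_iUnion hA
  have hWm := hWo.measurableSet
  have habs1 : ∀ x ∉ W, P x W = 0 := by
    intro x hx
    refine measure_iUnion_null fun n => ?_
    by_contra h
    refine hx (mem_iUnion.2 ⟨n + 1, ?_⟩)
    change 0 < (P ^ (n + 1)) x U₁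
    rw [add_comm, Kernel.pow_add_apply_eq_lintegral _ _ _ _ hU₁.measurableSet, pow_one,
      pos_iff_ne_zero]
    intro h0
    rw [lintegral_eq_zero_iff ((P ^ n).measurable_coe hU₁.measurableSet)] at h0
    exact h (measure_mono_null (fun y (hy : 0 < (P ^ n) y U₁) => hy.ne') (ae_iff.1 h0))
  have habs : ∀ n, ∀ x ∉ W, (P ^ n) x W = 0 := by
    intro n
    induction n with
    | zero =>
      intro x hx
      change Measure.dirac x W = 0
      rw [Measure.dirac_apply' _ hWm, indicator_of_notMem hx]
    | succ n ih =>
      intro x hx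
      rw [Kernel.pow_succ_apply_eq_lintegral _ _ _ hWm,
        lintegral_eq_zero_iff (P.measurable_coe hWm)]
      refine ae_iff.2 (measure_mono_null (fun y hy => ?_) (ih x hx))
      by_contra hyW
      exact hy (habs1 y hyW)
  -- The complement of `W` is absorbing, so it retains all its mass; as `μ` is invariant and finite,
  -- no mass may flow in from `W`.
  have hesc : ∀ n, ∀ᵐ x ∂μ, x ∈ W → (P ^ n) x Wᶜ = 0 := by
    intro n
    have h1 : μ Wᶜ = ∫⁻ x, (P ^ n) x Wᶜ ∂μ := by
      conv_lhs => rw [← (invariant_pow hμ n).def]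
      exact Measure.bind_apply hWm.compl (P ^ n).aemeasurable
    rw [← lintegral_add_compl _ hWm] at h1
    have h2 : ∫⁻ x in Wᶜ, (P ^ n) x Wᶜ ∂μ = μ Wᶜ := by
      rw [setLIntegral_congr_fun hWm.compl (g := fun _ => 1), setLIntegral_one]
      intro x hx
      have := prob_compl_eq_one_sub (μ := (P ^ n) x) hWm
      simpa [habs n x hx] using this
    rw [h2] at h1
    have h3 : ∫⁻ x in W, (P ^ n) x Wᶜ ∂μ = 0 := by
      have hfin := measure_ne_top μ Wᶜ
      by_contra h
      have := ENNReal.lt_add_right hfin h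
      rw [add_comm] at this
      exact this.ne h1
    rw [lintegral_eq_zero_iff ((P ^ n).measurable_coe hWm.compl)] at h3
    exact (ae_restrict_iff' hWm).1 h3
  -- At a point of the closure outside `W`, the local minorizing measure would be null on `W`
  -- because the point cannot enter `W`, and null on the complement because almost every nearby
  -- point of `W` cannot leave it.
  have hWc : IsClosed W := by
    refine isClosed_of_closure_subset fun x₀ hx₀ => ?_
    by_contra hx₀W
    obtain ⟨m, U, ν, hU, hxU, hν, hmin⟩ := hloc x₀
    have hW0 : ν W = 0 := le_antisymm ((hmin x₀ hxU W).trans (habs m x₀ hx₀W).le) zero_le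
    have hne : (U ∩ W).Nonempty := mem_closure_iff.1 hx₀ U hU hxU
    have hpos := (hU.inter hWo).measure_pos μ hne
    obtain ⟨x, ⟨hxU', hxW⟩, hx⟩ : ∃ x ∈ U ∩ W, (P ^ m) x Wᶜ = 0 := by
      by_contra! h
      refine hpos.ne' (measure_mono_null (fun x hx => ?_) (ae_iff.1 (hesc m)))
      simp only [mem_ofPred_eq, Classical.not_imp]
      exact ⟨hx.2, h x hx⟩
    have hW1 : ν Wᶜ = 0 := le_antisymm ((hmin x hxU' _).trans hx.le) zero_le
    refine hν (Measure.measure_univ_eq_zero.1 ?_)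
    rw [← union_compl_self W]
    exact measure_union_null hW0 hW1
  have hWu : W = univ := by
    refine IsClopen.eq_univ ⟨hWc, hWo⟩ ⟨x₁, mem_iUnion.2 ⟨0, ?_⟩⟩
    change 0 < Measure.dirac x₁ U₁
    rw [Measure.dirac_apply' _ hU₁.measurableSet, indicator_of_mem hxU₁]
    exact zero_lt_one
  obtain ⟨n, hn⟩ := isCompact_univ.elim_directed_cover A hA hWu.ge hmono.directed_le
  -- Taking `n + 1` steps keeps the final exponent positive even if `n` and `m₁` are both zero.
  obtain ⟨y, -, hy⟩ := LowerSemicontinuousOn.exists_isMinOn univ_nonempty isCompact_univ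
    ((hlsc (n + 1)).lowerSemicontinuousOn univ)
  have hδ : 0 < (P ^ (n + 1)) y U₁ := hmono n.le_succ (hn (mem_univ y))
  refine ⟨n + 1 + m₁, (P ^ (n + 1)) y U₁ • ν₁, by omega, ?_, fun x => ?_⟩
  · intro h
    have := congrArg (fun ν : Measure X => ν univ) h
    simp [hδ.ne', hν₁] at this
  · refine le_trans ?_ (smul_le_pow_add hU₁.measurableSet hmin₁ (n + 1) x)
    refine Measure.le_iff.2 fun s _ => ?_
    rw [Measure.smul_apply, Measure.smul_apply, smul_eq_mul, smul_eq_mul]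
    exact mul_le_mul_left (isMinOn_iff.1 hy x (mem_univ x)) _

end Topological

/-! ### Pushforward of a density under a family of submersions -/

section LocalMinorization

variable {W E : Type*} [NormedAddCommGroup W] [NormedSpace ℝ W] [FiniteDimensional ℝ W]
  [NormedAddCommGroup E] [NormedSpace ℝ E] [FiniteDimensional ℝ E] [MeasurableSpace E]
  [BorelSpace E]

/-- If the partial derivative of `F` with respect to the second variable is invertible at
`(w₀, t₀)`, then the images under `F w` of a measure with a positive density near `t₀` have a
uniformly positive density on a common open set, for `w` near `w₀`. -/
theorem exists_smul_restrict_le_map {μ : Measure E} [μ.IsAddHaarMeasure] {F : W × E → E}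
    (hF : ContDiff ℝ 1 F) {w₀ : W} {t₀ : E}
    (hinj : ∀ v : E, fderiv ℝ F (w₀, t₀) (0, v) = 0 → v = 0) {Q : Set E} (hQ : IsOpen Q)
    (ht₀ : t₀ ∈ Q) {Λ : Measure E} {c : ℝ≥0∞} (hc : c ≠ 0) (hΛ : c • μ.restrict Q ≤ Λ) :
    ∃ (U : Set W) (V : Set E) (c' : ℝ≥0∞), IsOpen U ∧ w₀ ∈ U ∧ IsOpen V ∧ V.Nonempty ∧ c' ≠ 0 ∧
      ∀ w ∈ U, c' • μ.restrict V ≤ Λ.map fun t => F (w, t) := by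
  let D : W × E → E →L[ℝ] E := fun p => (fderiv ℝ F p).comp (ContinuousLinearMap.inr ℝ W E)
  have hD : ∀ w t, HasFDerivAt (fun t => F (w, t)) (D (w, t)) t := fun w t =>
    ((hF.differentiable one_ne_zero) (w, t)).hasFDerivAt.comp t (hasFDerivAt_prodMk_right w t)
  have hDc : Continuous fun p => |(D p).det| := by
    have : Continuous D := (hF.continuous_fderiv one_ne_zero).clm_comp continuous_const
    exact (ContinuousLinearMap.continuous_det.comp this).abs
  -- Keeping `w` as a coordinate makes the derivative invertible, and openness of `G` at the base
  -- point then yields one target set `V` valid for all nearby `w`.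
  let G : W × E → W × E := fun p => (p.1, F p)
  let G' : W × E →L[ℝ] W × E := (ContinuousLinearMap.fst ℝ W E).prod (fderiv ℝ F (w₀, t₀))
  have hG : HasStrictFDerivAt G G' (w₀, t₀) :=
    hasStrictFDerivAt_fst.prodMk (hF.contDiffAt.hasStrictFDerivAt one_ne_zero)
  have hsurj : G'.range = ⊤ := by
    have hi : Function.Injective (G' : W × E →ₗ[ℝ] W × E) := by
      refine (injective_iff_map_eq_zero _).2 fun p hp => ?_
      obtain ⟨w, v⟩ := p
      obtain ⟨h1, h2⟩ := Prod.mk_inj.1 hp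
      have h1 : w = 0 := h1
      subst h1
      rw [hinj v h2]
      rfl
    exact LinearMap.range_eq_top.2 (LinearMap.injective_iff_surjective.1 hi)
  set J : ℝ := |(D (w₀, t₀)).det| + 1 with hJ
  have hJ0 : 0 < J := by positivity
  let S : Set (W × E) := {p | p.2 ∈ Q ∧ |(D p).det| < J}
  have hS : IsOpen S := (hQ.preimage continuous_snd).inter (isOpen_lt hDc continuous_const)
  have hS0 : (w₀, t₀) ∈ S := ⟨ht₀, by linarith⟩
  have hGS : G '' S ∈ 𝓝 (w₀, F (w₀, t₀)) := by
    have := hG.map_nhds_eq_of_surj hsurj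
    change _ ∈ 𝓝 (G (w₀, t₀))
    rw [← this]
    exact image_mem_map (hS.mem_nhds hS0)
  obtain ⟨U, V, hU, hwU, hV, hyV, hUV⟩ := mem_nhds_prod_iff'.1 hGS
  refine ⟨U, V, c * (ENNReal.ofReal J)⁻¹, hU, hwU, hV, ⟨_, hyV⟩, ?_, fun w hw => ?_⟩
  · simp [hc]
  refine Measure.le_iff.2 fun B hB => ?_
  have hFw : Measurable fun t => F (w, t) := (by fun_prop : Continuous fun t => F (w, t)).measurable
  rw [Measure.map_apply hFw hB, Measure.smul_apply, smul_eq_mul, Measure.restrict_apply hB]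
  let T : Set E := {t | (w, t) ∈ S} ∩ (fun t => F (w, t)) ⁻¹' B
  have hT : MeasurableSet T := (hS.preimage (by fun_prop)).measurableSet.inter (hFw hB)
  have hsub : B ∩ V ⊆ (fun t => F (w, t)) '' T := by
    rintro y ⟨hyB, hyV⟩
    obtain ⟨⟨w', t⟩, hp, heq⟩ := hUV (mk_mem_prod hw hyV)
    obtain ⟨h1, h2⟩ := Prod.mk_inj.1 heq
    have h1 : w' = w := h1
    subst h1
    exact ⟨t, ⟨hp, by rwa [mem_preimage, h2]⟩, h2⟩
  -- Only the inequality in the area formula is used, so `F w` need not be injective.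
  have hle : μ (B ∩ V) ≤ ENNReal.ofReal J * μ T := by
    calc μ (B ∩ V) ≤ μ ((fun t => F (w, t)) '' T) := measure_mono hsub
      _ ≤ ∫⁻ t in T, ENNReal.ofReal |(D (w, t)).det| ∂μ :=
        addHaar_image_le_lintegral_abs_det_fderiv μ hT fun t _ => (hD w t).hasFDerivWithinAt
      _ ≤ ∫⁻ _ in T, ENNReal.ofReal J ∂μ :=
        setLIntegral_mono' hT fun t ht => ENNReal.ofReal_le_ofReal ht.1.2.le
      _ = ENNReal.ofReal J * μ T := setLIntegral_const _ _
  have hTΛ : c * μ T ≤ Λ ((fun t => F (w, t)) ⁻¹' B) := by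
    have h := hΛ T
    rw [Measure.smul_apply, smul_eq_mul, Measure.restrict_apply hT,
      inter_eq_self_of_subset_left fun t ht => ht.1.1] at h
    exact h.trans (measure_mono inter_subset_right)
  calc c * (ENNReal.ofReal J)⁻¹ * μ (B ∩ V)
      ≤ c * (ENNReal.ofReal J)⁻¹ * (ENNReal.ofReal J * μ T) := by gcongr
    _ = c * μ T := by
      rw [mul_assoc, ← mul_assoc _ (ENNReal.ofReal J), ENNReal.inv_mul_cancel (by simpa using hJ0)
        ENNReal.ofReal_ne_top, one_mul]
    _ ≤ _ := hTΛ

end LocalMinorization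

/-! ### Densities of the exponential times -/

section ProductLaw

theorem pi_mono_measure {ι : Type*} [Fintype ι] {α : ι → Type*} [∀ i, MeasurableSpace (α i)]
    {μ ν : ∀ i, Measure (α i)} [∀ i, SigmaFinite (μ i)] [∀ i, SigmaFinite (ν i)]
    (h : ∀ i, μ i ≤ ν i) : Measure.pi μ ≤ Measure.pi ν := by
  refine Measure.le_iff.2 fun s hs => ?_
  rw [Measure.pi, Measure.pi, toMeasure_apply _ _ hs, toMeasure_apply _ _ hs]
  -- The product outer measure is the largest one bounded by the product on boxes, so a comparison
  -- on boxes suffices.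
  refine OuterMeasure.le_pi.2 (fun t ht => ?_) s
  refine (OuterMeasure.pi_pi_le _ _).trans ?_
  exact Finset.prod_le_prod' fun i _ => h i _

/-- The exponential law has a positive density on bounded intervals. -/
theorem exists_smul_restrict_le_expMeasure {r : ℝ} (hr : 0 < r) (R : ℝ) :
    ∃ c : ℝ≥0∞, c ≠ 0 ∧ c ≠ ∞ ∧ c • (volume.restrict (Ioo 0 R)) ≤ expMeasure r := by
  -- The density decreases on the interval, so its value at `R` is a lower bound.
  refine ⟨ENNReal.ofReal (r * Real.exp (-(r * R))), ?_, ENNReal.ofReal_ne_top, ?_⟩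
  · simpa using by positivity
  · refine Measure.le_iff.2 fun s hs => ?_
    rw [Measure.smul_apply, smul_eq_mul, Measure.restrict_apply hs, ← setLIntegral_const]
    have h1 : expMeasure r s = ∫⁻ x in s, exponentialPDF r x := withDensity_apply _ hs
    rw [h1]
    refine le_trans (setLIntegral_mono' (hs.inter measurableSet_Ioo) fun x hx => ?_)
      (lintegral_mono_set inter_subset_left)
    rw [exponentialPDF_of_nonneg hx.2.1.le]
    refine ENNReal.ofReal_le_ofReal ?_
    have := hx.2.2.le
    gcongr

theorem exists_smul_restrict_le_pi_expMeasure {r : ℝ} (hr : 0 < r) (R : ℝ) :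
    ∃ c : ℝ≥0∞, c ≠ 0 ∧ c • (volume.restrict (univ.pi fun _ : Fin 3 => Ioo 0 R)) ≤
      Measure.pi fun _ : Fin 3 => expMeasure r := by
  obtain ⟨c, hc, hc', hle⟩ := exists_smul_restrict_le_expMeasure hr R
  have := isProbabilityMeasure_expMeasure hr
  -- A finite constant makes the scaled factors σ-finite, as `pi_mono_measure` requires.
  lift c to NNReal using hc'
  refine ⟨(c : ℝ≥0∞) ^ 3, by simpa using hc, ?_⟩
  rw [volume_pi, Measure.restrict_pi_pi]
  refine le_trans (le_of_eq ?_) (pi_mono_measure (μ := fun _ => c • volume.restrict (Ioo 0 R))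
    fun _ => hle)
  refine (Measure.pi_eq fun s hs => ?_).symm
  simp only [Measure.smul_apply, Measure.pi_pi,
    Fin.prod_univ_three, smul_eq_mul, Measure.nnreal_smul_coe_apply]
  ring

theorem pi_expMeasure_ne_zero {r : ℝ} (hr : 0 < r) {A : Set (Fin 3 → ℝ)} (hA : IsOpen A)
    {t : Fin 3 → ℝ} (ht : t ∈ A) (htpos : ∀ i, 0 < t i) :
    (Measure.pi fun _ : Fin 3 => expMeasure r) A ≠ 0 := by
  obtain ⟨c, hc, hle⟩ := exists_smul_restrict_le_pi_expMeasure hr (t 0 + t 1 + t 2 + 1)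
  have hQ : IsOpen (univ.pi fun _ : Fin 3 => Ioo 0 (t 0 + t 1 + t 2 + 1)) :=
    isOpen_set_pi finite_univ fun _ _ => isOpen_Ioo
  have htQ : t ∈ univ.pi fun _ : Fin 3 => Ioo 0 (t 0 + t 1 + t 2 + 1) := by
    have h0 := htpos 0
    have h1 := htpos 1
    have h2 := htpos 2
    intro i _
    refine ⟨htpos i, ?_⟩
    fin_cases i <;> simp <;> linarith
  have hpos := (hA.inter hQ).measure_pos (volume : Measure (Fin 3 → ℝ)) ⟨t, ht, htQ⟩
  have h := hle A
  rw [Measure.smul_apply, smul_eq_mul, Measure.restrict_apply hA.measurableSet] at h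
  exact ((ENNReal.mul_pos hc hpos.ne').trans_le h).ne'

end ProductLaw

/-! ### Invariance of Lebesgue measure under the flows -/

section Invariance

/-- A shear `x ↦ x + s x` of a commutative group preserves translation-invariant probability
measures, if translations by the range of `p` leave `s` unchanged and `p` commutes with translation
by the values of `s`. -/
theorem lintegral_add_shear {G : Type*} [AddCommGroup G] [MeasurableSpace G] [MeasurableAdd₂ G]
    {μ : Measure G} [IsProbabilityMeasure μ] [μ.IsAddLeftInvariant] {p : G → G}
    (hp : Measurable p) {s : G → G} (hs : Measurable s) (hsp : ∀ x v, s (x + p v) = s x)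
    (hps : ∀ v x, p (v + s x) = p v + s x) {g : G → ℝ≥0∞} (hg : Measurable g) :
    ∫⁻ x, g (x + s x) ∂μ = ∫⁻ x, g x ∂μ := by
  have h1 : ∀ v, ∫⁻ x, g (x + p v + s x) ∂μ = ∫⁻ x, g (x + s x) ∂μ := fun v => by
    rw [← lintegral_add_right_eq_self (fun x => g (x + s x)) (p v)]
    simp only [hsp]
  have h2 : ∀ x, ∫⁻ v, g (x + p v + s x) ∂μ = ∫⁻ v, g (x + p v) ∂μ := fun x => by
    rw [← lintegral_add_right_eq_self (fun v => g (x + p v)) (s x)]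
    simp only [hps, add_assoc]
  calc ∫⁻ x, g (x + s x) ∂μ = ∫⁻ v, ∫⁻ x, g (x + p v + s x) ∂μ ∂μ := by simp [h1]
    _ = ∫⁻ x, ∫⁻ v, g (x + p v + s x) ∂μ ∂μ :=
      lintegral_lintegral_swap (by fun_prop)
    _ = ∫⁻ x, ∫⁻ v, g (x + p v) ∂μ ∂μ := by simp only [h2]
    _ = ∫⁻ v, ∫⁻ x, g (x + p v) ∂μ ∂μ := lintegral_lintegral_swap (by fun_prop)
    _ = ∫⁻ x, g x ∂μ := by simp [lintegral_add_right_eq_self]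

instance isProbabilityMeasure_lebesgue : IsProbabilityMeasure lebesgue := by
  refine ⟨?_⟩
  rw [lebesgue, Measure.smul_apply, smul_eq_mul]
  refine ENNReal.inv_mul_cancel ?_ (measure_ne_top _ _)
  exact isOpen_univ.measure_ne_zero _ univ_nonempty

instance isAddLeftInvariant_lebesgue : lebesgue.IsAddLeftInvariant := by
  unfold lebesgue; infer_instance

instance isOpenPosMeasure_lebesgue : lebesgue.IsOpenPosMeasure :=
  Measure.isOpenPosMeasure_smul _ (ENNReal.inv_ne_zero.2 (measure_ne_top _ _))

theorem lintegral_flow {f : Fin 3 → Circ → ℝ} (hf : IsAdmissible f) (i : Fin 3) (t : ℝ)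
    {g : Torus → ℝ≥0∞} (hg : Measurable g) :
    ∫⁻ x, g (flow f i t x) ∂lebesgue = ∫⁻ x, g x ∂lebesgue := by
  have hs : Measurable fun (x : Torus) (j : Fin 3) => ((t * vectorField f i x j : ℝ) : Circ) := by
    have := (hf.continuous_vectorField i).measurable
    refine measurable_pi_lambda _ fun j => (AddCircle.continuous_mk' _).measurable.comp ?_
    fun_prop
  have hup : ∀ k : Fin 3, Measurable fun x : Torus => Function.update x k 0 := fun k =>
    (continuous_id.update k continuous_const).measurable
  -- With indices mod 3, `X_i` depends only on coordinate `i + 2` and has zero component there; `p`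
  -- erases exactly that coordinate.
  refine lintegral_add_shear (μ := lebesgue) (p := fun x => Function.update x (i + 2) 0)
    (hup _) hs ?_ ?_ hg
  · intro x v
    funext j
    fin_cases i <;> fin_cases j <;> simp [vectorField]
  · intro v x
    funext j
    fin_cases i <;> fin_cases j <;> simp [vectorField]

end Invariance

/-! ### The one-point kernel as the law of one cycle -/

section OneStep

/-- One cycle of the splitting as a function of the three times. -/
noncomputable def cycle (f : Fin 3 → Circ → ℝ) (t : Fin 3 → ℝ) (x : Torus) : Torus :=
  flow f 2 (t 2) (flow f 1 (t 1) (flow f 0 (t 0) x))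

variable {f : Fin 3 → Circ → ℝ}

theorem IsAdmissible.continuous_cycle (hf : IsAdmissible f) :
    Continuous fun p : (Fin 3 → ℝ) × Torus => cycle f p.1 p.2 := by
  have h0 := hf.continuous_flow 0
  have h1 := hf.continuous_flow 1
  have h2 := hf.continuous_flow 2
  have k0 : Continuous fun p : (Fin 3 → ℝ) × Torus => flow f 0 (p.1 0) p.2 :=
    h0.comp (by fun_prop : Continuous fun p : (Fin 3 → ℝ) × Torus => (p.1 0, p.2))
  have k1 : Continuous fun p : (Fin 3 → ℝ) × Torus => flow f 1 (p.1 1) (flow f 0 (p.1 0) p.2) :=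
    h1.comp (by fun_prop :
      Continuous fun p : (Fin 3 → ℝ) × Torus => (p.1 1, flow f 0 (p.1 0) p.2))
  exact h2.comp (by fun_prop : Continuous fun p : (Fin 3 → ℝ) × Torus =>
    (p.1 2, flow f 1 (p.1 1) (flow f 0 (p.1 0) p.2)))

theorem IsAdmissible.continuous_cycle_left (hf : IsAdmissible f) (x : Torus) :
    Continuous fun t => cycle f t x :=
  hf.continuous_cycle.comp (by fun_prop : Continuous fun t : Fin 3 → ℝ => (t, x))

theorem IsAdmissible.continuous_cycle_right (hf : IsAdmissible f) (t : Fin 3 → ℝ) :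
    Continuous fun x => cycle f t x :=
  hf.continuous_cycle.comp (by fun_prop : Continuous fun x : Torus => (t, x))

theorem cycle_zero (x : Torus) : cycle f 0 x = x := by
  funext j
  simp [cycle, flow]

theorem cycle_apply (t : Fin 3 → ℝ) (x : Torus) :
    cycle f t x =
      let u : Circ := x 0 + ((t 0 * f 0 (x 2) : ℝ) : Circ)
      let v : Circ := x 1 + ((t 0 * circDeriv (f 0) (x 2) : ℝ) : Circ) + ((t 1 * f 1 u : ℝ) : Circ)
      ![u + ((t 2 * circDeriv (f 2) v : ℝ) : Circ), v,
        x 2 + ((t 1 * circDeriv (f 1) u : ℝ) : Circ) + ((t 2 * f 2 v : ℝ) : Circ)] := by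
  funext j
  fin_cases j <;> simp [cycle, flow, vectorField]

theorem lintegral_cycle (hf : IsAdmissible f) (t : Fin 3 → ℝ) {g : Torus → ℝ≥0∞}
    (hg : Measurable g) : ∫⁻ x, g (cycle f t x) ∂lebesgue = ∫⁻ x, g x ∂lebesgue := by
  have hm : ∀ i, Measurable (flow f i (t i)) := fun i =>
    ((hf.continuous_flow i).comp (by fun_prop : Continuous fun x : Torus => (t i, x))).measurable
  unfold cycle
  rw [lintegral_flow hf 0 (t 0)
      (g := fun x => g (flow f 2 (t 2) (flow f 1 (t 1) x))) (hg.comp ((hm 2).comp (hm 1))),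
    lintegral_flow hf 1 (t 1) (g := fun x => g (flow f 2 (t 2) x)) (hg.comp (hm 2)),
    lintegral_flow hf 2 (t 2) hg]

variable {h : ℝ} {Ω : Type*} [MeasurableSpace Ω] {Pr : Measure Ω} [IsProbabilityMeasure Pr]
  {τ : ℕ → Ω → ℝ}

instance isMarkovKernel_onePointKernel (hf : IsAdmissible f) (hτ : ∀ n, Measurable (τ n)) :
    IsMarkovKernel (onePointKernel hf Pr hτ) :=
  ⟨fun _ => Measure.isProbabilityMeasure_map
    ((hf.measurable_splitting hτ 1).comp measurable_prodMk_left).aemeasurable⟩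

theorem onePointKernel_apply (hf : IsAdmissible f) (hτ : ∀ n, Measurable (τ n))
    (hindep : iIndepFun τ Pr) (hlaw : ∀ n, Pr.map (τ n) = expMeasure h⁻¹) (x : Torus) :
    onePointKernel hf Pr hτ x =
      (Measure.pi fun _ : Fin 3 => expMeasure h⁻¹).map fun t => cycle f t x := by
  have h1 : iIndepFun (fun i : Fin 3 => τ i) Pr := hindep.precomp Fin.val_injective
  have h2 := (iIndepFun_iff_map_fun_eq_pi_map fun i : Fin 3 => (hτ i).aemeasurable).1 h1
  simp only [hlaw] at h2
  rw [← h2, Measure.map_map (hf.continuous_cycle_left x).measurable (by fun_prop)]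
  rfl

/-- The cycle is continuous in the starting point for fixed times, and Fatou's lemma carries lower
semicontinuity through the integral over the times. -/
theorem lowerSemicontinuous_lintegral_onePointKernel (hf : IsAdmissible f)
    (hτ : ∀ n, Measurable (τ n)) (hindep : iIndepFun τ Pr)
    (hlaw : ∀ n, Pr.map (τ n) = expMeasure h⁻¹) (g : Torus → ℝ≥0∞) (hg : LowerSemicontinuous g) :
    LowerSemicontinuous fun x => ∫⁻ y, g y ∂onePointKernel hf Pr hτ x := by
  have hgm := hg.measurable
  simp only [onePointKernel_apply hf hτ hindep hlaw]
  simp only [fun x => lintegral_map (μ := Measure.pi fun _ : Fin 3 => expMeasure h⁻¹) hgm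
    (hf.continuous_cycle_left x).measurable]
  intro x
  refine lowerSemicontinuousAt_iff_le_liminf.2 (le_trans (lintegral_mono fun t => ?_)
    (lintegral_liminf_le fun y => hgm.comp (hf.continuous_cycle_left y).measurable))
  exact lowerSemicontinuousAt_iff_le_liminf.1
    ((hg.comp (hf.continuous_cycle_right t)).lowerSemicontinuousAt x)

theorem onePointKernel_apply_ne_zero (hf : IsAdmissible f) (hh : 0 < h)
    (hτ : ∀ n, Measurable (τ n)) (hindep : iIndepFun τ Pr)
    (hlaw : ∀ n, Pr.map (τ n) = expMeasure h⁻¹) {x : Torus} {O : Set Torus} (hO : IsOpen O)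
    {t : Fin 3 → ℝ} (ht : ∀ i, 0 < t i) (htO : cycle f t x ∈ O) :
    onePointKernel hf Pr hτ x O ≠ 0 := by
  have hc := hf.continuous_cycle_left x
  rw [onePointKernel_apply hf hτ hindep hlaw, Measure.map_apply hc.measurable hO.measurableSet]
  exact pi_expMeasure_ne_zero (inv_pos.2 hh) (hO.preimage hc) htO ht

/-- Small positive times barely move the point. -/
theorem onePointKernel_apply_ne_zero_of_mem (hf : IsAdmissible f) (hh : 0 < h)
    (hτ : ∀ n, Measurable (τ n)) (hindep : iIndepFun τ Pr)
    (hlaw : ∀ n, Pr.map (τ n) = expMeasure h⁻¹) {x : Torus} {O : Set Torus} (hO : IsOpen O)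
    (hx : x ∈ O) : onePointKernel hf Pr hτ x O ≠ 0 := by
  have hc : Continuous fun e : ℝ => cycle f (fun _ => e) x :=
    (hf.continuous_cycle_left x).comp (by fun_prop : Continuous fun (e : ℝ) (_ : Fin 3) => e)
  have h0 : {e : ℝ | cycle f (fun _ => e) x ∈ O} ∈ 𝓝 0 := by
    refine (hO.preimage hc).mem_nhds ?_
    change cycle f 0 x ∈ O
    rwa [cycle_zero]
  have h1 : {e : ℝ | cycle f (fun _ => e) x ∈ O} ∩ Ioi 0 ∈ 𝓝[>] (0 : ℝ) :=
    inter_mem (mem_nhdsWithin_of_mem_nhds h0) self_mem_nhdsWithin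
  obtain ⟨e, he, hpos⟩ := Filter.nonempty_of_mem h1
  exact onePointKernel_apply_ne_zero hf hh hτ hindep hlaw hO (fun _ => hpos) he

/-- By Tonelli the starting point can be averaged first, with the times fixed, and each such cycle
preserves Lebesgue measure. -/
theorem invariant_lebesgue (hf : IsAdmissible f) (hh : 0 < h)
    (hτ : ∀ n, Measurable (τ n)) (hindep : iIndepFun τ Pr)
    (hlaw : ∀ n, Pr.map (τ n) = expMeasure h⁻¹) :
    (onePointKernel hf Pr hτ).Invariant lebesgue := by
  have := isProbabilityMeasure_expMeasure (inv_pos.2 hh)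
  have hmeas := hf.continuous_cycle.measurable
  refine Measure.ext fun s hs => ?_
  have h1 : Measurable (s.indicator (1 : Torus → ℝ≥0∞)) := measurable_one.indicator hs
  have h2 : ∀ x, onePointKernel hf Pr hτ x s =
      ∫⁻ t, s.indicator 1 (cycle f t x) ∂Measure.pi fun _ : Fin 3 => expMeasure h⁻¹ := fun x => by
    rw [← lintegral_indicator_one hs, onePointKernel_apply hf hτ hindep hlaw,
      lintegral_map h1 (hf.continuous_cycle_left x).measurable]
  rw [Measure.bind_apply hs (Kernel.aemeasurable _)]
  simp only [h2]
  have h3 : Measurable (Function.uncurry fun (x : Torus) (t : Fin 3 → ℝ) =>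
      s.indicator (1 : Torus → ℝ≥0∞) (cycle f t x)) := h1.comp (hmeas.comp measurable_swap)
  rw [lintegral_lintegral_swap h3.aemeasurable]
  simp [lintegral_cycle hf _ h1, lintegral_indicator_one hs]

end OneStep

/-! ### Zeros of the profiles, and the cycle lifted to `ℝ³` -/

section Profiles

variable {f : Fin 3 → Circ → ℝ}

theorem exists_pos_coe_eq (y : Circ) : ∃ d : ℝ, 0 < d ∧ (d : Circ) = y := by
  have h : y ∈ ((↑) : ℝ → Circ) '' Ioc 0 (0 + 2 * Real.pi) := by
    rw [AddCircle.coe_image_Ioc_eq]; exact mem_univ y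
  obtain ⟨d, hd, rfl⟩ := h
  exact ⟨d, hd.1, rfl⟩

/-- A line with non-zero speed reaches every point of the circle at a positive time. -/
theorem exists_pos_add_coe_mul_eq {a : ℝ} (ha : a ≠ 0) (x y : Circ) :
    ∃ t : ℝ, 0 < t ∧ x + ((t * a : ℝ) : Circ) = y := by
  rcases lt_or_gt_of_ne ha with ha | ha
  · obtain ⟨d, hd, hdy⟩ := exists_pos_coe_eq (x - y)
    refine ⟨d / -a, div_pos hd (neg_pos.2 ha), ?_⟩
    have : d / -a * a = -d := by field_simp
    rw [this, AddCircle.coe_neg, hdy]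
    abel
  · obtain ⟨d, hd, hdy⟩ := exists_pos_coe_eq (y - x)
    refine ⟨d / a, div_pos hd ha, ?_⟩
    rw [div_mul_cancel₀ _ ha.ne', hdy]
    abel

theorem IsAdmissible.exists_ne_zero (hf : IsAdmissible f) (i : Fin 3) : ∃ y, f i y ≠ 0 := by
  by_contra! h
  exact hf.nonconst i ⟨0, h⟩

/-- The derivative vanishes at a maximum, which exists by compactness of the circle. -/
theorem IsAdmissible.exists_circDeriv_eq_zero (hf : IsAdmissible f) (i : Fin 3) :
    ∃ y, circDeriv (f i) y = 0 := by
  obtain ⟨y, -, hy⟩ := isCompact_univ.exists_isMaxOn univ_nonempty (hf.continuous i).continuousOn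
  refine ⟨y, IsLocalMax.deriv_eq_zero (Eventually.of_forall fun t => ?_)⟩
  simpa using isMaxOn_iff.1 hy (y + (t : Circ)) (mem_univ _)

/-- The profile `f i` as a `2π`-periodic function. -/
noncomputable def profile (f : Fin 3 → Circ → ℝ) (i : Fin 3) (s : ℝ) : ℝ := f i (s : Circ)

theorem IsAdmissible.contDiff_profile (hf : IsAdmissible f) (i : Fin 3) :
    ContDiff ℝ 2 (profile f i) :=
  contDiffOn_univ.1 (hf.analytic i).contDiffOn_of_completeSpace

theorem IsAdmissible.contDiff_deriv_profile (hf : IsAdmissible f) (i : Fin 3) :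
    ContDiff ℝ 1 (deriv (profile f i)) :=
  contDiffOn_univ.1 (hf.analytic i).deriv.contDiffOn_of_completeSpace

theorem IsAdmissible.hasDerivAt_profile (hf : IsAdmissible f) (i : Fin 3) (s : ℝ) :
    HasDerivAt (profile f i) (deriv (profile f i) s) s :=
  ((hf.contDiff_profile i).differentiable two_ne_zero s).hasDerivAt

theorem IsAdmissible.hasDerivAt_deriv_profile (hf : IsAdmissible f) (i : Fin 3) (s : ℝ) :
    HasDerivAt (deriv (profile f i)) (deriv (deriv (profile f i)) s) s :=
  ((hf.contDiff_deriv_profile i).differentiable one_ne_zero s).hasDerivAt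

/-- The projection `ℝ³ → 𝕋³`. -/
noncomputable def torusMk (w : Fin 3 → ℝ) : Torus := fun j => (w j : Circ)

theorem continuous_torusMk : Continuous torusMk :=
  continuous_pi fun j => (AddCircle.continuous_mk' _).comp (continuous_apply j)

theorem isOpenMap_torusMk : IsOpenMap torusMk :=
  IsOpenMap.piMap (fun _ => QuotientAddGroup.isOpenMap_coe)
    (by simp)

theorem surjective_torusMk : Function.Surjective torusMk := fun x => by
  choose w hw using fun j => exists_pos_coe_eq (x j)
  exact ⟨w, funext fun j => (hw j).2⟩

/-- First coordinate after the first flow, on the universal cover. -/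
noncomputable def liftFst (f : Fin 3 → Circ → ℝ) (p : (Fin 3 → ℝ) × (Fin 3 → ℝ)) : ℝ :=
  p.1 0 + p.2 0 * profile f 0 (p.1 2)

/-- Second coordinate after the second flow, on the universal cover. -/
noncomputable def liftSnd (f : Fin 3 → Circ → ℝ) (p : (Fin 3 → ℝ) × (Fin 3 → ℝ)) : ℝ :=
  p.1 1 + p.2 0 * deriv (profile f 0) (p.1 2) + p.2 1 * profile f 1 (liftFst f p)

/-- One cycle of the splitting on the universal cover. -/
noncomputable def liftCycle (f : Fin 3 → Circ → ℝ) (p : (Fin 3 → ℝ) × (Fin 3 → ℝ)) : Fin 3 → ℝ :=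
  ![liftFst f p + p.2 2 * deriv (profile f 2) (liftSnd f p), liftSnd f p,
    p.1 2 + p.2 1 * deriv (profile f 1) (liftFst f p) + p.2 2 * profile f 2 (liftSnd f p)]

theorem torusMk_liftCycle (w t : Fin 3 → ℝ) :
    torusMk (liftCycle f (w, t)) = cycle f t (torusMk w) := by
  have hp : ∀ i s, profile f i s = f i (s : Circ) := fun _ _ => rfl
  have hd : ∀ i s, deriv (profile f i) s = circDeriv (f i) (s : Circ) :=
    fun i s => (circDeriv_coe (f i) s).symm
  rw [cycle_apply]
  funext j
  fin_cases j <;> simp [torusMk, liftCycle, liftFst, liftSnd, hp, hd]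

theorem IsAdmissible.contDiff_liftCycle (hf : IsAdmissible f) : ContDiff ℝ 1 (liftCycle f) := by
  have h1 := fun i => (hf.contDiff_profile i).of_le one_le_two
  have h2 := hf.contDiff_deriv_profile
  have hu : ContDiff ℝ 1 (liftFst f) := by
    have := (h1 0).comp (by fun_prop : ContDiff ℝ 1 fun p : (Fin 3 → ℝ) × (Fin 3 → ℝ) => p.1 2)
    unfold liftFst
    simp only [Function.comp_def] at this
    fun_prop
  have hv : ContDiff ℝ 1 (liftSnd f) := by
    have a1 := (h2 0).comp (by fun_prop : ContDiff ℝ 1 fun p : (Fin 3 → ℝ) × (Fin 3 → ℝ) => p.1 2)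
    have a2 := (h1 1).comp hu
    unfold liftSnd
    simp only [Function.comp_def] at a1 a2
    fun_prop
  have a1 := (h2 2).comp hv
  have a2 := (h2 1).comp hu
  have a3 := (h1 2).comp hv
  simp only [Function.comp_def] at a1 a2 a3
  refine contDiff_pi.2 fun j => ?_
  fin_cases j <;> simp [liftCycle] <;> fun_prop

/-- The cycle is a submersion in the times where `f₁(x₃) ≠ 0`, `f₂ ≠ 0` after the first flow and
`f₃' = 0` after the second. -/
theorem IsAdmissible.eq_zero_of_fderiv_liftCycle_eq_zero (hf : IsAdmissible f) {w t : Fin 3 → ℝ}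
    (h0 : profile f 0 (w 2) ≠ 0) (h1 : profile f 1 (liftFst f (w, t)) ≠ 0)
    (h2 : profile f 2 (liftSnd f (w, t)) ≠ 0)
    (h2' : deriv (profile f 2) (liftSnd f (w, t)) = 0)
    {v : Fin 3 → ℝ} (hv : fderiv ℝ (liftCycle f) (w, t) (0, v) = 0) : v = 0 := by
  let l : ℝ → (Fin 3 → ℝ) × (Fin 3 → ℝ) := fun e => (w, t + e • v)
  have hl0 : l 0 = (w, t) := by simp [l]
  have hl : HasDerivAt l (0, v) 0 := by
    refine (hasDerivAt_const _ _).prodMk ?_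
    simpa using ((hasDerivAt_id (0 : ℝ)).smul_const v).const_add t
  have hF : HasDerivAt (fun e => liftCycle f (l e)) 0 0 := by
    rw [← hv, ← hl0]
    exact ((hf.contDiff_liftCycle.differentiable one_ne_zero) (l 0)).hasFDerivAt.comp_hasDerivAt
      (0 : ℝ) hl
  have hFj := hasDerivAt_pi.1 hF
  have ht : ∀ j, HasDerivAt (fun e => (l e).2 j) (v j) 0 := fun j => by
    simpa [l] using ((hasDerivAt_id (0 : ℝ)).mul_const (v j)).const_add (t j)
  have hu : HasDerivAt (fun e => liftFst f (l e)) (v 0 * profile f 0 (w 2)) 0 :=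
    ((ht 0).mul_const (profile f 0 (w 2))).const_add (w 0)
  have hu0 : liftFst f (l 0) = liftFst f (w, t) := by rw [hl0]
  have hsnd0 : liftSnd f (l 0) = liftSnd f (w, t) := by rw [hl0]
  have hsnd : HasDerivAt (fun e => liftSnd f (l e)) 0 0 := hFj 1
  have e0 : v 0 * profile f 0 (w 2) = 0 := by
    -- The second coordinate has zero derivative along `v`, and `h2'` removes the direct effect of
    -- the third time, so only `v 0` remains. The system is then triangular: `v 1` and `v 2` follow
    -- from the second and third coordinates.
    have h := hu.add ((ht 2).mul ((hf.hasDerivAt_deriv_profile 2 (liftSnd f (l 0))).comp 0 hsnd))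
    have := (hFj 0).unique h
    simp only [Function.comp_apply, hsnd0, h2', mul_zero, add_zero] at this
    exact this.symm
  have v0 : v 0 = 0 := (mul_eq_zero.1 e0).resolve_right h0
  rw [e0] at hu
  have v1 : v 1 = 0 := by
    have h := (((ht 0).mul_const (deriv (profile f 0) (w 2))).const_add (w 1)).add
      ((ht 1).mul ((hf.hasDerivAt_profile 1 (liftFst f (l 0))).comp 0 hu))
    have := hsnd.unique h
    simp only [Function.comp_apply, hu0, v0, zero_mul, mul_zero, add_zero, zero_add] at this
    exact (mul_eq_zero.1 this.symm).resolve_right h1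
  have v2 : v 2 = 0 := by
    have h := (((ht 1).mul ((hf.hasDerivAt_deriv_profile 1 (liftFst f (l 0))).comp 0 hu)).const_add
      (w 2)).add ((ht 2).mul ((hf.hasDerivAt_profile 2 (liftSnd f (l 0))).comp 0 hsnd))
    have := (hFj 2).unique h
    simp only [Function.comp_apply, hsnd0, v1, zero_mul, mul_zero, add_zero, zero_add] at this
    exact (mul_eq_zero.1 this.symm).resolve_right h2
  funext j
  fin_cases j
  · exact v0
  · exact v1
  · exact v2

end Profiles

/-! ### Local minorization of the chain -/

section Minorization

variable {f : Fin 3 → Circ → ℝ} {h : ℝ} {Ω : Type*} [MeasurableSpace Ω] {Pr : Measure Ω}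
  [IsProbabilityMeasure Pr] {τ : ℕ → Ω → ℝ}

theorem exists_local_minorization_of_ne_zero (hf : IsAdmissible f) (hh : 0 < h)
    (hτ : ∀ n, Measurable (τ n)) (hindep : iIndepFun τ Pr)
    (hlaw : ∀ n, Pr.map (τ n) = expMeasure h⁻¹) {x₀ : Torus} (hx₀ : f 0 (x₀ 2) ≠ 0) :
    ∃ (U : Set Torus) (ν : Measure Torus), IsOpen U ∧ x₀ ∈ U ∧ ν ≠ 0 ∧
      ∀ x ∈ U, ν ≤ onePointKernel hf Pr hτ x := by
  obtain ⟨w, rfl⟩ := surjective_torusMk x₀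
  have h0 : profile f 0 (w 2) ≠ 0 := hx₀
  obtain ⟨y₁, hy₁⟩ := hf.exists_ne_zero 1
  obtain ⟨y₂, hy₂⟩ := hf.exists_circDeriv_eq_zero 2
  have hy₂' : f 2 y₂ ≠ 0 := fun h => hf.no_common_zero 2 y₂ ⟨h, hy₂⟩
  -- The first time steers to `y₁`, where the second flow can move the second coordinate; the second
  -- time then steers that coordinate to the critical point `y₂`. The third time is arbitrary and
  -- set to `1`.
  obtain ⟨t₀, ht₀, hu⟩ := exists_pos_add_coe_mul_eq h0 (w 0 : Circ) y₁
  obtain ⟨t₁, ht₁, hv⟩ := exists_pos_add_coe_mul_eq hy₁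
    ((w 1 + t₀ * deriv (profile f 0) (w 2) : ℝ) : Circ) y₂
  let t : Fin 3 → ℝ := ![t₀, t₁, 1]
  have htpos : ∀ i, 0 < t i := fun i => by
    fin_cases i <;> simp [t, ht₀, ht₁]
  have hu' : ((liftFst f (w, t) : ℝ) : Circ) = y₁ := by
    rw [← hu]; simp [liftFst, t]
  have hp1 : profile f 1 (liftFst f (w, t)) = f 1 y₁ := by rw [profile, hu']
  have hv' : ((liftSnd f (w, t) : ℝ) : Circ) = y₂ := by
    rw [← hv, liftSnd, hp1]; simp [t]
  have hp2 : profile f 2 (liftSnd f (w, t)) = f 2 y₂ := by rw [profile, hv']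
  have hp2' : deriv (profile f 2) (liftSnd f (w, t)) = 0 := by
    rw [← hy₂, ← hv', circDeriv_coe]; rfl
  set R : ℝ := t₀ + t₁ + 2
  obtain ⟨c, hc, hle⟩ := exists_smul_restrict_le_pi_expMeasure (inv_pos.2 hh) R
  have hQ : IsOpen (univ.pi fun _ : Fin 3 => Ioo 0 R) :=
    isOpen_set_pi finite_univ fun _ _ => isOpen_Ioo
  have htQ : t ∈ univ.pi fun _ : Fin 3 => Ioo 0 R := fun i _ => by
    refine ⟨htpos i, ?_⟩
    fin_cases i <;> simp [t, R] <;> linarith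
  obtain ⟨U, V, c', hU, hwU, hV, hVne, hc', hmin⟩ :=
    exists_smul_restrict_le_map (μ := volume) hf.contDiff_liftCycle
      (fun v => hf.eq_zero_of_fderiv_liftCycle_eq_zero h0 (hp1 ▸ hy₁) (hp2 ▸ hy₂') hp2')
      hQ htQ hc hle
  refine ⟨torusMk '' U, (c' • volume.restrict V).map torusMk, isOpenMap_torusMk U hU,
    mem_image_of_mem _ hwU, ?_, ?_⟩
  · rw [Ne, Measure.map_eq_zero_iff continuous_torusMk.aemeasurable, ← Measure.measure_univ_eq_zero]
    simp [hc', (hV.measure_pos volume hVne).ne']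
  · rintro _ ⟨w', hw', rfl⟩
    have hmeas : Measurable fun t => liftCycle f (w', t) :=
      (hf.contDiff_liftCycle.continuous.comp (by fun_prop : Continuous fun t => (w', t))).measurable
    rw [onePointKernel_apply hf hτ hindep hlaw]
    simp only [← torusMk_liftCycle]
    rw [← Function.comp_def torusMk, ← Measure.map_map continuous_torusMk.measurable hmeas]
    exact Measure.map_mono (hmin w' hw') continuous_torusMk.measurable

/-- At a zero of `f 0` the first flow moves only the second coordinate. It can therefore be timed so
that the third flow, acting where `f 2 ≠ 0`, brings the third coordinate to a point where `f 0 ≠ 0`.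
-/
theorem exists_cycle_profile_ne_zero (hf : IsAdmissible f) {x : Torus} (hx : f 0 (x 2) = 0) :
    ∃ t : Fin 3 → ℝ, (∀ i, 0 < t i) ∧ f 0 (cycle f t x 2) ≠ 0 := by
  have hx' : circDeriv (f 0) (x 2) ≠ 0 := fun h => hf.no_common_zero 0 _ ⟨hx, h⟩
  obtain ⟨y₀, hy₀⟩ := hf.exists_ne_zero 0
  obtain ⟨y₂, hy₂⟩ := hf.exists_ne_zero 2
  obtain ⟨t₀, ht₀, hv⟩ := exists_pos_add_coe_mul_eq hx' (x 1 + (f 1 (x 0) : Circ)) y₂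
  obtain ⟨t₂, ht₂, hz⟩ := exists_pos_add_coe_mul_eq hy₂
    (x 2 + (circDeriv (f 1) (x 0) : Circ)) y₀
  refine ⟨![t₀, 1, t₂], fun i => by fin_cases i <;> simp [ht₀, ht₂], ?_⟩
  rw [add_right_comm] at hv
  rw [cycle_apply]
  simp [hx, hv, hz, hy₀]

theorem exists_local_minorization (hf : IsAdmissible f) (hh : 0 < h)
    (hτ : ∀ n, Measurable (τ n)) (hindep : iIndepFun τ Pr)
    (hlaw : ∀ n, Pr.map (τ n) = expMeasure h⁻¹) (x₀ : Torus) :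
    ∃ (m : ℕ) (U : Set Torus) (ν : Measure Torus), IsOpen U ∧ x₀ ∈ U ∧ ν ≠ 0 ∧
      ∀ x ∈ U, ν ≤ (onePointKernel hf Pr hτ ^ m) x := by
  by_cases hx₀ : f 0 (x₀ 2) = 0
  · obtain ⟨t, ht, hne⟩ := exists_cycle_profile_ne_zero hf hx₀
    obtain ⟨U, ν, hU, hxU, hν, hmin⟩ :=
      exists_local_minorization_of_ne_zero hf hh hτ hindep hlaw hne
    set P := onePointKernel hf Pr hτ
    have hpos : P x₀ U ≠ 0 := onePointKernel_apply_ne_zero hf hh hτ hindep hlaw hU ht hxU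
    have hlsc : LowerSemicontinuous fun x => (P ^ 1) x U := lowerSemicontinuous_pow_apply
      (lowerSemicontinuous_lintegral_onePointKernel hf hτ hindep hlaw) 1 hU
    rw [← pow_one P] at hpos
    have hmin' : ∀ x ∈ U, ν ≤ (P ^ 1) x := by simpa using hmin
    have hfin : (P ^ 1) x₀ U ≠ ∞ := by
      rw [pow_one]; exact measure_ne_top _ _
    -- Lower semicontinuity keeps the probability of entering `U` above half its value at `x₀` on a
    -- neighbourhood; a second cycle then applies the minorization valid on `U`.
    refine ⟨1 + 1, {x | (P ^ 1) x₀ U / 2 < (P ^ 1) x U}, ((P ^ 1) x₀ U / 2) • ν,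
      hlsc.isOpen_preimage _, ENNReal.half_lt_self hpos hfin, ?_, fun x hx => ?_⟩
    · rw [Ne, ← Measure.measure_univ_eq_zero]
      simp only [Measure.smul_apply, smul_eq_mul, mul_eq_zero, Measure.measure_univ_eq_zero, hν,
        or_false]
      exact (ENNReal.half_pos hpos).ne'
    · refine le_trans ?_ (smul_le_pow_add hU.measurableSet hmin' 1 x)
      refine Measure.le_iff.2 fun s _ => ?_
      rw [Measure.smul_apply, Measure.smul_apply, smul_eq_mul, smul_eq_mul]
      exact mul_le_mul_left (mem_ofPred_eq ▸ hx).le _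
  · obtain ⟨U, ν, hU, hxU, hν, hmin⟩ :=
      exists_local_minorization_of_ne_zero hf hh hτ hindep hlaw hx₀
    exact ⟨1, U, ν, hU, hxU, hν, by simpa using hmin⟩

end Minorization

end RandomSplitting

/-! ### Conclusion -/

theorem theorem2p2 {f : Fin 3 → RandomSplitting.Circ → ℝ} (hf : RandomSplitting.IsAdmissible f)
    {h : ℝ} (hh : 0 < h) {Ω : Type*} [MeasurableSpace Ω] (Pr : Measure Ω) [IsProbabilityMeasure Pr]
    {τ : ℕ → Ω → ℝ} (hτ : ∀ n, Measurable (τ n)) (hindep : iIndepFun τ Pr)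
    (hlaw : ∀ n, Pr.map (τ n) = expMeasure h⁻¹) :
    RandomSplitting.IsUniformlyGeometricallyErgodic (RandomSplitting.onePointKernel hf Pr hτ) ∧
      ∀ μ : Measure RandomSplitting.Torus,
        RandomSplitting.IsStationary (RandomSplitting.onePointKernel hf Pr hτ) μ ↔
          μ = RandomSplitting.lebesgue := by
  open RandomSplitting in
  set P := onePointKernel hf Pr hτ
  have hinv : P.Invariant lebesgue := invariant_lebesgue hf hh hτ hindep hlaw
  obtain ⟨N, ν, hN, hν0, hν⟩ := exists_minorization
    (lowerSemicontinuous_lintegral_onePointKernel hf hτ hindep hlaw)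
    (fun x O hO hx => onePointKernel_apply_ne_zero_of_mem hf hh hτ hindep hlaw hO hx) hinv
    (exists_local_minorization hf hh hτ hindep hlaw)
  have hmk := isMarkovKernel_pow P
  have : IsFiniteMeasure ν := isFiniteMeasure_of_le _ (hν 0)
  obtain ⟨C, γ, hC, hγ0, hγ1, hbound⟩ := exists_geometric_bound_of_minorization hinv hN hν0 hν
  have huniq : ∀ μ : Measure Torus, IsStationary P μ → μ = lebesgue := fun μ hμ => by
    have := hμ.1
    exact eq_of_geometric_bound hμ.2 hγ0 hγ1 hbound
  have hstat : IsStationary P lebesgue := ⟨inferInstance, hinv⟩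
  refine ⟨⟨lebesgue, hstat, huniq, C, γ, hC, hγ0, hγ1, fun m x g hg => ?_⟩,
    fun μ => ⟨huniq μ, fun h => h ▸ hstat⟩⟩
  have hr : ∀ y, |g y| ≤ weightedNorm (fun _ => 1) g := fun y => by
    simpa [weightedNorm] using le_ciSup hg.2 y
  have hab : ∀ y, g y ∈ Set.Icc (-weightedNorm (fun _ => 1) g) (weightedNorm (fun _ => 1) g) :=
    fun y => abs_le.1 (hr y)
  refine ⟨integrable_of_mem_Icc hg.1 hab, integrable_of_mem_Icc hg.1 hab, ?_⟩
  rw [mul_one]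
  exact hbound m x g _ hg.1 hr
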